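/- Let $\mathcal P(\mathcal X)$ be the set of probability measures with finite first moment on $\mathcal X$, and let $\mu,\nu\in\mathcal P(\mathbb R)$ be in convex order: $\int f\,d\mu\le\int f\,d\nu$ for every convex $f:\mathbb R\to\mathbb R$. Let $\mathcal M(\mu,\nu)$ be the set of laws $\pi\in\mathcal P(\mathbb R^2)$ of pairs $(X,Y)$ with $X\sim\mu$, $Y\sim\nu$ and $\mathbb E_\pi[Y\mid X]=X$. Let $c_1:\mathbb R\to\mathbb R$, $c_1=c_1(x)$, and $c_2:\mathbb R^2\to\mathbb R$, $c_2=c_2(x,y)$, be continuous, and assume that there are continuous $v\in L^1(\mu)$, $w\in L^1(\nu)$ with $|c_1(x)|+|c_2(x,y)|\le v(x)+w(y)$ for all $x,y\in\mathbb R$. For $\pi\in\mathcal M(\mu,\nu)$ with disintegration $\pi=\pi_x\otimes\mu$ and a nonnegative measure $\mu_1\le\mu$, put $\mu_2=\mu-\mu_1$ and $\gamma_l=\pi_x\otimes\mu_l$ for $l=1,2$, and define $$P_c=\sup_{\pi\in\mathcal M(\mu,\nu)}\ \sup_{\mu_1\le\mu}\ \Big(\int c_1(x)\,d\gamma_1+\int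 c_2(x,y)\,d\gamma_2\Big).$$ A pair $(\pi,\mu_1)$ with $\pi\in\mathcal M(\mu,\nu)$ and $\mu_1\le\mu$ that attains this supremum is called optimal. Let $\overline{\mathcal M}$ be the set of finite measures $\gamma\ge 0$ on $\mathbb R^2$ such that $\gamma=0$ or $\gamma/\gamma(\mathbb R^2)\in\mathcal M(\mu',\nu')$ for some $\mu',\nu'\in\mathcal P(\mathbb R)$ in convex order, and define the relaxed value $$\overline P_c=\sup\Big\{\int c_1(x)\,d\gamma_1+\int c_2(x,y)\,d\gamma_2\ :\ \gamma_1,\gamma_2\in\overline{\mathcal M},\ \gamma_1+\gamma_2\in\mathcal M(\mu,\nu)\Big\}.$$ Suppose that for $\mu$-a.e. $x$ the function $y\mapsto c_2(x,y)$ is strictly convex on $\mathbb R$ and $c_1(x)\ne c_2(x,x)$, that $\nu$ is absolutely continuous with respect to Lebesgue measure, and that $P_c=\overline P_c$. Then every optimal pair $(\pi,\mu_1)$ satisfies $\mu_1\perp\mu-\mu_1$. Furthermore, for each $\pi$ there is at most one $\mu_1$ such that $(\pi,\mu_1)$ is optimal. -/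

import Mathlib

open MeasureTheory ProbabilityTheory
open scoped ENNReal

noncomputable section

namespace AmericanOption

/-- `m` is a probability measure with finite first moment. -/
def FiniteMomentProb {E : Type*} [NormedAddCommGroup E] [MeasurableSpace E]
    (m : Measure E) : Prop :=
  IsProbabilityMeasure m ∧ Integrable (fun x : E => ‖x‖) m

/-- Convex order of two probability measures on `ℝ` with finite first moment: `μ(f) ≤ ν(f)` for
every convex `f`. Such an `f` dominates an affine function, so both integrals are well defined in
`(-∞, ∞]`; the inequality is void if `ν(f) = ∞`, and otherwise says that `μ(f)` is finite too and
at most `ν(f)`. -/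
def ConvexOrder (μ ν : Measure ℝ) : Prop :=
  ∀ f : ℝ → ℝ, ConvexOn ℝ Set.univ f → Integrable f ν →
    Integrable f μ ∧ ∫ x, f x ∂μ ≤ ∫ y, f y ∂ν

/-- The set `M(μ, ν)` of martingale transports: laws `π` on `ℝ × ℝ` (with finite first moment) of a
pair `(X, Y)` with `X ∼ μ`, `Y ∼ ν` and `E[Y | X] = X`. -/
def martingaleTransports (μ ν : Measure ℝ) : Set (Measure (ℝ × ℝ)) :=
  {π | FiniteMomentProb π ∧ π.map Prod.fst = μ ∧ π.map Prod.snd = ν ∧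
    π[(Prod.snd : ℝ × ℝ → ℝ) | MeasurableSpace.comap (Prod.fst : ℝ × ℝ → ℝ) inferInstance]
      =ᵐ[π] (Prod.fst : ℝ × ℝ → ℝ)}

/-- All martingale transports between some two marginals in convex order. -/
def allMartingaleTransports : Set (Measure (ℝ × ℝ)) :=
  {π | ∃ μ ν : Measure ℝ, FiniteMomentProb μ ∧ FiniteMomentProb ν ∧ ConvexOrder μ ν ∧
    π ∈ martingaleTransports μ ν}

/-- Martingale transports of arbitrary finite total mass. -/
def finiteMartingaleTransports : Set (Measure (ℝ × ℝ)) :=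
  {γ | γ = 0 ∨ (γ Set.univ ≠ 0 ∧ γ Set.univ ≠ ∞ ∧
    (γ Set.univ)⁻¹ • γ ∈ allMartingaleTransports)}

/-- `E_{γ₁}[c₁(X)] + E_{γ₂}[c₂(X, Y)]`. -/
def pairPayoff (c₁ : ℝ → ℝ) (c₂ : ℝ → ℝ → ℝ) (γ₁ γ₂ : Measure (ℝ × ℝ)) : ℝ :=
  (∫ p, c₁ p.1 ∂γ₁) + (∫ p, c₂ p.1 p.2 ∂γ₂)

/-- The expected payoff of the model `π` with exercise scheme `μ₁`, that is, the payoff of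
`γ₁ = π_x ⊗ μ₁` and `γ₂ = π_x ⊗ (μ - μ₁)`, where `π_x` is the disintegration kernel of `π` with
respect to its first marginal. -/
def payoff (c₁ : ℝ → ℝ) (c₂ : ℝ → ℝ → ℝ) (μ : Measure ℝ)
    (π : ProbabilityMeasure (ℝ × ℝ)) (μ₁ : Measure ℝ) : ℝ :=
  pairPayoff c₁ c₂ (μ₁ ⊗ₘ (π : Measure (ℝ × ℝ)).condKernel)
    ((μ - μ₁) ⊗ₘ (π : Measure (ℝ × ℝ)).condKernel)

/-- The value `P_c`. -/
def value (c₁ : ℝ → ℝ) (c₂ : ℝ → ℝ → ℝ) (μ ν : Measure ℝ) : EReal :=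
  ⨆ (π : ProbabilityMeasure (ℝ × ℝ)) (_ : (π : Measure (ℝ × ℝ)) ∈ martingaleTransports μ ν)
    (μ₁ : Measure ℝ) (_ : μ₁ ≤ μ), ((payoff c₁ c₂ μ π μ₁ : ℝ) : EReal)

/-- The relaxed value: `γ₁`, `γ₂` are martingale transports of finite mass whose sum
lies in `M(μ, ν)`, but they need not share a kernel. -/
def relaxedValue (c₁ : ℝ → ℝ) (c₂ : ℝ → ℝ → ℝ) (μ ν : Measure ℝ) : EReal :=
  ⨆ (γ₁ : Measure (ℝ × ℝ)) (γ₂ : Measure (ℝ × ℝ))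
    (_ : γ₁ ∈ finiteMartingaleTransports) (_ : γ₂ ∈ finiteMartingaleTransports)
    (_ : γ₁ + γ₂ ∈ martingaleTransports μ ν), ((pairPayoff c₁ c₂ γ₁ γ₂ : ℝ) : EReal)

/-- `(π, μ₁)` is a solution of the problem defining `value`: it is admissible and attains `P_c`. -/
def IsOptimalPair (c₁ : ℝ → ℝ) (c₂ : ℝ → ℝ → ℝ) (μ ν : Measure ℝ)
    (π : ProbabilityMeasure (ℝ × ℝ)) (μ₁ : Measure ℝ) : Prop :=
  (π : Measure (ℝ × ℝ)) ∈ martingaleTransports μ ν ∧ μ₁ ≤ μ ∧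
    ((payoff c₁ c₂ μ π μ₁ : ℝ) : EReal) = value c₁ c₂ μ ν

end AmericanOption

end

/-! Let `ρ` lie below both `μ₁` and `μ - μ₁`, and let `κ` be the kernel of `π`. Then `ρ ⊗ₘ κ` sits
inside both `γ₁` and `γ₂`, and the point is that it must vanish. Since `P_c` equals the relaxed
value, `(γ₁, γ₂)` is also optimal among pairs that need not share a kernel, so mass may be exchanged
between the two components. Draw `y₁, y₂` from one fibre `κ x`, and `(x', z)` independently. If `y₁
< z < y₂`, merge `y₁, y₂` into `z` over `x` in `γ₁`, which costs nothing because `c₁` ignores `y`,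
and split `z` into `y₁, y₂` over `x'` in `γ₂`, which gains by strict convexity. Hence this almost
never happens (`IsRelaxedOptimal.ae_not_between`). As the second marginal has no atoms, each fibre
collapses to a point, by the martingale property `x` itself (`ae_snd_eq_fst_of_ae_not_between`). On
the diagonal mass moves freely between the components, so `c₁ x ≠ c₂ x x` leaves no mass
(`IsRelaxedOptimal.eq_zero_of_diagonal`). For fixed `π` the payoff is affine in `μ₁`. The midpoint
of two optimal schemes is therefore optimal, and its singularity forces the two to agree. -/

namespace AmericanOption

/-! ### Martingale couplings, with the martingale property in integrated form -/

/-- A finite measure on `ℝ × ℝ` with finite first moment under which the second coordinate has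
conditional barycentre equal to the first one. -/
structure IsMartingaleCoupling (γ : Measure (ℝ × ℝ)) : Prop where
  isFiniteMeasure : IsFiniteMeasure γ
  integrable_fst : Integrable (fun p : ℝ × ℝ => p.1) γ
  integrable_snd : Integrable (fun p : ℝ × ℝ => p.2) γ
  setIntegral_eq_zero : ∀ S : Set ℝ, MeasurableSet S →
    ∫ p in Prod.fst ⁻¹' S, (p.2 - p.1) ∂γ = 0

lemma integrable_fst_snd_of_norm {γ : Measure (ℝ × ℝ)}
    (h : Integrable (fun p : ℝ × ℝ => ‖p‖) γ) :
    Integrable (fun p : ℝ × ℝ => p.1) γ ∧ Integrable (fun p : ℝ × ℝ => p.2) γ :=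
  ⟨h.mono' (by fun_prop) (.of_forall fun p => norm_fst_le p),
    h.mono' (by fun_prop) (.of_forall fun p => norm_snd_le p)⟩

lemma integrable_norm_of_fst_snd {γ : Measure (ℝ × ℝ)}
    (h₁ : Integrable (fun p : ℝ × ℝ => p.1) γ) (h₂ : Integrable (fun p : ℝ × ℝ => p.2) γ) :
    Integrable (fun p : ℝ × ℝ => ‖p‖) γ := by
  refine (h₁.norm.add h₂.norm).mono' (by fun_prop) (.of_forall fun p => ?_)
  rw [norm_norm]
  exact max_le (le_add_of_nonneg_right (norm_nonneg _)) (le_add_of_nonneg_left (norm_nonneg _))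

lemma integrable_integral_compProd {ρ : Measure ℝ} {κ : Kernel ℝ ℝ} [IsFiniteMeasure ρ]
    [IsMarkovKernel κ] {f : ℝ × ℝ → ℝ} (hf : Integrable f (ρ ⊗ₘ κ)) :
    Integrable (fun x => ∫ y, f (x, y) ∂κ x) ρ := by
  simpa using Integrable.integral_compProd (κ := Kernel.const Unit ρ)
    (η := Kernel.prodMkLeft Unit κ) (a := ()) hf

lemma compProd_mono_left {ρ μ : Measure ℝ} {κ : Kernel ℝ ℝ} [IsFiniteMeasure μ]
    [IsMarkovKernel κ] (hρ : ρ ≤ μ) : ρ ⊗ₘ κ ≤ μ ⊗ₘ κ := by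
  have := isFiniteMeasure_of_le μ hρ
  refine Measure.le_iff.mpr fun s hs => ?_
  rw [Measure.compProd_apply hs, Measure.compProd_apply hs]
  exact lintegral_mono' hρ le_rfl

lemma isMartingaleCoupling_of_mem {μ ν : Measure ℝ} {π : Measure (ℝ × ℝ)}
    (h : π ∈ martingaleTransports μ ν) : IsMartingaleCoupling π := by
  obtain ⟨⟨hp, hint⟩, -, -, hc⟩ := h
  obtain ⟨h₁, h₂⟩ := integrable_fst_snd_of_norm hint
  refine ⟨inferInstance, h₁, h₂, fun S hS => ?_⟩
  have hS' : MeasurableSet[MeasurableSpace.comap (Prod.fst : ℝ × ℝ → ℝ) inferInstance]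
      (Prod.fst ⁻¹' S) := ⟨S, hS, rfl⟩
  have hle : MeasurableSpace.comap (Prod.fst : ℝ × ℝ → ℝ) inferInstance
      ≤ (inferInstance : MeasurableSpace (ℝ × ℝ)) := measurable_fst.comap_le
  rw [integral_sub h₂.integrableOn h₁.integrableOn, sub_eq_zero,
    ← setIntegral_condExp hle h₂ hS']
  exact integral_congr_ae (ae_restrict_of_ae hc)

namespace IsMartingaleCoupling

lemma condExp_eq {π : Measure (ℝ × ℝ)} (h : IsMartingaleCoupling π) :
    π[(Prod.snd : ℝ × ℝ → ℝ) | MeasurableSpace.comap (Prod.fst : ℝ × ℝ → ℝ) inferInstance]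
      =ᵐ[π] (Prod.fst : ℝ × ℝ → ℝ) := by
  have := h.isFiniteMeasure
  have hle : MeasurableSpace.comap (Prod.fst : ℝ × ℝ → ℝ) inferInstance
      ≤ (inferInstance : MeasurableSpace (ℝ × ℝ)) := measurable_fst.comap_le
  refine (ae_eq_condExp_of_forall_setIntegral_eq hle h.integrable_snd
    (fun s _ _ => h.integrable_fst.integrableOn) ?_ ?_).symm
  · rintro s ⟨S, hS, rfl⟩ -
    have := h.setIntegral_eq_zero S hS
    rw [integral_sub h.integrable_snd.integrableOn h.integrable_fst.integrableOn,
      sub_eq_zero] at this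
    exact this.symm
  · exact (comap_measurable (Prod.fst : ℝ × ℝ → ℝ)).stronglyMeasurable.aestronglyMeasurable

lemma ae_barycenter {ρ : Measure ℝ} {κ : Kernel ℝ ℝ} [IsFiniteMeasure ρ] [IsMarkovKernel κ]
    (h : IsMartingaleCoupling (ρ ⊗ₘ κ)) :
    ∀ᵐ x ∂ρ, Integrable (fun y => y) (κ x) ∧ ∫ y, y ∂κ x = x := by
  have hsub : Integrable (fun p : ℝ × ℝ => p.2 - p.1) (ρ ⊗ₘ κ) :=
    h.integrable_snd.sub h.integrable_fst
  have h0 : (fun x => ∫ y, (y - x) ∂κ x) =ᵐ[ρ] 0 := by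
    refine Integrable.ae_eq_zero_of_forall_setIntegral_eq_zero ?_ ?_
    · exact integrable_integral_compProd hsub
    · intro S hS _
      rw [← h.setIntegral_eq_zero S hS, ← Set.prod_univ,
        Measure.setIntegral_compProd hS MeasurableSet.univ hsub.integrableOn]
      simp
  have hi := ((Measure.integrable_compProd_iff (by fun_prop)).mp h.integrable_snd).1
  filter_upwards [h0, hi] with x hx hix
  refine ⟨hix, ?_⟩
  rw [integral_sub hix (integrable_const _)] at hx
  simpa [sub_eq_zero] using hx

/-- The barycentre condition concerns almost every single fibre of `κ`, so it survives shrinking the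
first marginal. -/
lemma compProd_of_le {ρ μ : Measure ℝ} {κ : Kernel ℝ ℝ} [IsFiniteMeasure μ] [IsMarkovKernel κ]
    (h : IsMartingaleCoupling (μ ⊗ₘ κ)) (hρ : ρ ≤ μ) : IsMartingaleCoupling (ρ ⊗ₘ κ) := by
  have := isFiniteMeasure_of_le μ hρ
  have hle : ρ ⊗ₘ κ ≤ μ ⊗ₘ κ := compProd_mono_left hρ
  have h₁ := h.integrable_fst.mono_measure hle
  have h₂ := h.integrable_snd.mono_measure hle
  refine ⟨inferInstance, h₁, h₂, fun S hS => ?_⟩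
  have hsub : Integrable (fun p : ℝ × ℝ => p.2 - p.1) (ρ ⊗ₘ κ) := h₂.sub h₁
  rw [← Set.prod_univ, Measure.setIntegral_compProd hS MeasurableSet.univ hsub.integrableOn]
  simp only [Measure.restrict_univ]
  refine integral_eq_zero_of_ae (ae_restrict_of_ae ?_)
  filter_upwards [(Measure.absolutelyContinuous_of_le hρ).ae_le h.ae_barycenter] with x hx
  rw [integral_sub hx.1 (integrable_const _), hx.2]
  simp

/-- Jensen's inequality on the fibres. Integrability of `f` under the first marginal follows by
squeezing it between an affine minorant and its fibre averages. -/
lemma convexOrder {π : Measure (ℝ × ℝ)} (h : IsMartingaleCoupling π) [IsProbabilityMeasure π] :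
    ConvexOrder (π.map Prod.fst) (π.map Prod.snd) := by
  intro f hf hint
  have hfc : Continuous f := by
    rw [← continuousOn_univ]
    exact hf.continuousOn isOpen_univ
  have hdis : (π.map Prod.fst) ⊗ₘ π.condKernel = π := π.disintegrate π.condKernel
  have hpm : IsProbabilityMeasure (π.map Prod.fst) :=
    Measure.isProbabilityMeasure_map measurable_fst.aemeasurable
  have hint' : Integrable (fun p : ℝ × ℝ => f p.2) ((π.map Prod.fst) ⊗ₘ π.condKernel) := by
    rw [hdis]
    exact (integrable_map_measure hfc.aestronglyMeasurable measurable_snd.aemeasurable).mp hint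
  have hm : IsMartingaleCoupling ((π.map Prod.fst) ⊗ₘ π.condKernel) := by rwa [hdis]
  have hJ : ∀ᵐ x ∂(π.map Prod.fst), f x ≤ ∫ y, f y ∂(π.condKernel x) := by
    filter_upwards [hm.ae_barycenter,
      ((Measure.integrable_compProd_iff (by fun_prop)).mp hint').1] with x hx hfx
    have := hf.map_integral_le (μ := π.condKernel x) (f := fun y => y)
      hfc.continuousOn isClosed_univ (by simp) hx.1 hfx
    rwa [hx.2] at this
  have hup : Integrable (fun x => ∫ y, f y ∂(π.condKernel x)) (π.map Prod.fst) :=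
    integrable_integral_compProd hint'
  have hid : Integrable (fun x : ℝ => x) (π.map Prod.fst) :=
    (integrable_map_measure (by fun_prop) measurable_fst.aemeasurable).mpr h.integrable_fst
  obtain ⟨a, b, hab⟩ : ∃ a b : ℝ, ∀ x, a * x + b ≤ f x := by
    simpa using hf.exists_affine_le_real isClosed_univ
      (hfc.lowerSemicontinuous.lowerSemicontinuousOn _)
  have hfi : Integrable f (π.map Prod.fst) := by
    refine ((hup.norm.add ((hid.const_mul a).add (integrable_const b)).norm)).mono'
      hfc.aestronglyMeasurable ?_
    filter_upwards [hJ] with x hx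
    simp only [Pi.add_apply, Real.norm_eq_abs]
    have := hab x
    rcases abs_cases (f x) with h | h <;>
      rcases abs_cases (∫ y, f y ∂(π.condKernel x)) with h' | h' <;>
      rcases abs_cases (a * x + b) with h'' | h'' <;> linarith
  refine ⟨hfi, (integral_mono_ae hfi hup hJ).trans_eq ?_⟩
  rw [← Measure.integral_compProd hint', hdis,
    integral_map measurable_snd.aemeasurable hfc.aestronglyMeasurable]

lemma smul {γ : Measure (ℝ × ℝ)} (h : IsMartingaleCoupling γ) {c : ℝ≥0∞} (hc : c ≠ ∞) :
    IsMartingaleCoupling (c • γ) := by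
  have := h.isFiniteMeasure
  refine ⟨Measure.smul_finite γ hc, h.integrable_fst.smul_measure hc,
    h.integrable_snd.smul_measure hc, fun S hS => ?_⟩
  rw [Measure.restrict_smul, integral_smul_measure, h.setIntegral_eq_zero S hS, smul_zero]

lemma mem_martingaleTransports {π : Measure (ℝ × ℝ)} (h : IsMartingaleCoupling π)
    [IsProbabilityMeasure π] :
    π ∈ martingaleTransports (π.map Prod.fst) (π.map Prod.snd) :=
  ⟨⟨inferInstance, integrable_norm_of_fst_snd h.integrable_fst h.integrable_snd⟩, rfl, rfl,
    h.condExp_eq⟩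

/-- Admits couplings built by exchanging mass as competitors in the relaxed problem. -/
lemma mem_finiteMartingaleTransports {γ : Measure (ℝ × ℝ)} (h : IsMartingaleCoupling γ) :
    γ ∈ finiteMartingaleTransports := by
  have := h.isFiniteMeasure
  by_cases h0 : γ = 0
  · exact Or.inl h0
  have hu : γ Set.univ ≠ 0 := by simpa using h0
  have hprob : IsProbabilityMeasure ((γ Set.univ)⁻¹ • γ) :=
    ⟨by simp [ENNReal.inv_mul_cancel hu (measure_ne_top γ _)]⟩
  have hm := h.smul (ENNReal.inv_ne_top.mpr hu)
  refine Or.inr ⟨hu, measure_ne_top γ _, _, _, ⟨?_, ?_⟩, ⟨?_, ?_⟩, hm.convexOrder,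
    hm.mem_martingaleTransports⟩
  · exact Measure.isProbabilityMeasure_map measurable_fst.aemeasurable
  · exact (integrable_map_measure (by fun_prop) measurable_fst.aemeasurable).mpr
      hm.integrable_fst.norm
  · exact Measure.isProbabilityMeasure_map measurable_snd.aemeasurable
  · exact (integrable_map_measure (by fun_prop) measurable_snd.aemeasurable).mpr
      hm.integrable_snd.norm

end IsMartingaleCoupling

/-! ### Exchanging mass in relaxed optimal pairs -/

/-- The martingale property sees `m` only through its integrated displacement `y - x` over sets of
first coordinates, so any `m'` with the same displacement can replace it. -/
lemma IsMartingaleCoupling.exchange {γ m m' : Measure (ℝ × ℝ)} (h : IsMartingaleCoupling γ)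
    [IsFiniteMeasure m'] (hle : m ≤ γ)
    (h₁ : Integrable (fun p : ℝ × ℝ => p.1) m') (h₂ : Integrable (fun p : ℝ × ℝ => p.2) m')
    (hb : ∀ S : Set ℝ, MeasurableSet S →
      ∫ p in Prod.fst ⁻¹' S, (p.2 - p.1) ∂m = ∫ p in Prod.fst ⁻¹' S, (p.2 - p.1) ∂m') :
    IsMartingaleCoupling (γ - m + m') := by
  have := h.isFiniteMeasure
  have := isFiniteMeasure_of_le γ hle
  have hsub : γ - m ≤ γ := Measure.sub_le
  have := isFiniteMeasure_of_le γ hsub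
  have hi {τ : Measure (ℝ × ℝ)} (hτ : τ ≤ γ) :
      Integrable (fun p : ℝ × ℝ => p.2 - p.1) τ :=
    (h.integrable_snd.mono_measure hτ).sub (h.integrable_fst.mono_measure hτ)
  have hi' : Integrable (fun p : ℝ × ℝ => p.2 - p.1) m' := h₂.sub h₁
  refine ⟨inferInstance, (h.integrable_fst.mono_measure hsub).add_measure h₁,
    (h.integrable_snd.mono_measure hsub).add_measure h₂, fun S hS => ?_⟩
  rw [Measure.restrict_add, integral_add_measure (hi hsub).integrableOn hi'.integrableOn,
    ← hb S hS, ← integral_add_measure (hi hsub).integrableOn (hi hle).integrableOn,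
    ← Measure.restrict_add, Measure.sub_add_cancel_of_le hle, h.setIntegral_eq_zero S hS]

/-- `γ₁`, `γ₂` solve the relaxed problem. -/
structure IsRelaxedOptimal (c₁ : ℝ → ℝ) (c₂ : ℝ → ℝ → ℝ) (μ ν : Measure ℝ)
    (γ₁ γ₂ : Measure (ℝ × ℝ)) : Prop where
  left : IsMartingaleCoupling γ₁
  right : IsMartingaleCoupling γ₂
  add_mem : γ₁ + γ₂ ∈ martingaleTransports μ ν
  le : ∀ γ₁' γ₂', IsMartingaleCoupling γ₁' → IsMartingaleCoupling γ₂' →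
    γ₁' + γ₂' ∈ martingaleTransports μ ν → pairPayoff c₁ c₂ γ₁' γ₂' ≤ pairPayoff c₁ c₂ γ₁ γ₂

/-- The integrability assumption on the payoffs. -/
def IsDominated (c₁ : ℝ → ℝ) (c₂ : ℝ → ℝ → ℝ) (μ ν : Measure ℝ) : Prop :=
  ∃ v w : ℝ → ℝ, Continuous v ∧ Continuous w ∧ Integrable v μ ∧ Integrable w ν ∧
    ∀ x y : ℝ, |c₁ x| + |c₂ x y| ≤ v x + w y

lemma IsDominated.integrable {c₁ : ℝ → ℝ} {c₂ : ℝ → ℝ → ℝ} {μ ν : Measure ℝ}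
    (hA : IsDominated c₁ c₂ μ ν) (hc₁ : Continuous c₁)
    (hc₂ : Continuous (fun p : ℝ × ℝ => c₂ p.1 p.2)) {τ : Measure (ℝ × ℝ)}
    (hfst : τ.map Prod.fst ≤ μ) (hsnd : τ.map Prod.snd ≤ ν) :
    Integrable (fun p : ℝ × ℝ => c₁ p.1) τ ∧ Integrable (fun p : ℝ × ℝ => c₂ p.1 p.2) τ := by
  obtain ⟨v, w, hvc, hwc, hv, hw, hvw⟩ := hA
  have hv' : Integrable (fun p : ℝ × ℝ => v p.1) τ :=
    (integrable_map_measure hvc.aestronglyMeasurable measurable_fst.aemeasurable).mp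
      (hv.mono_measure hfst)
  have hw' : Integrable (fun p : ℝ × ℝ => w p.2) τ :=
    (integrable_map_measure hwc.aestronglyMeasurable measurable_snd.aemeasurable).mp
      (hw.mono_measure hsnd)
  refine ⟨(hv'.add hw').mono' (by fun_prop) (.of_forall fun p => ?_),
    (hv'.add hw').mono' (by fun_prop) (.of_forall fun p => ?_)⟩
  · exact (le_add_of_nonneg_right (abs_nonneg _)).trans (hvw p.1 p.2)
  · exact (le_add_of_nonneg_left (abs_nonneg _)).trans (hvw p.1 p.2)

/-- Replacing `m₁ ≤ γ₁` by `m₁'` and `m₂ ≤ γ₂` by `m₂'`, with unchanged total marginals and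
barycentres, does not improve an optimal pair. -/
lemma IsRelaxedOptimal.exchange_le {c₁ : ℝ → ℝ} {c₂ : ℝ → ℝ → ℝ} {μ ν : Measure ℝ}
    {γ₁ γ₂ m₁ m₂ m₁' m₂' : Measure (ℝ × ℝ)} (h : IsRelaxedOptimal c₁ c₂ μ ν γ₁ γ₂)
    (hA : IsDominated c₁ c₂ μ ν) (hc₁ : Continuous c₁)
    (hc₂ : Continuous (fun p : ℝ × ℝ => c₂ p.1 p.2))
    (hm₁ : m₁ ≤ γ₁) (hm₂ : m₂ ≤ γ₂)
    (hfst : (m₁' + m₂').map Prod.fst = (m₁ + m₂).map Prod.fst)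
    (hsnd : (m₁' + m₂').map Prod.snd = (m₁ + m₂).map Prod.snd)
    (hb₁ : ∀ S : Set ℝ, MeasurableSet S →
      ∫ p in Prod.fst ⁻¹' S, (p.2 - p.1) ∂m₁ = ∫ p in Prod.fst ⁻¹' S, (p.2 - p.1) ∂m₁')
    (hb₂ : ∀ S : Set ℝ, MeasurableSet S →
      ∫ p in Prod.fst ⁻¹' S, (p.2 - p.1) ∂m₂ = ∫ p in Prod.fst ⁻¹' S, (p.2 - p.1) ∂m₂') :
    (Integrable (fun p : ℝ × ℝ => c₂ p.1 p.2) m₂ ∧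
      Integrable (fun p : ℝ × ℝ => c₂ p.1 p.2) m₂') ∧
    (∫ p, c₁ p.1 ∂m₁') + ∫ p, c₂ p.1 p.2 ∂m₂' ≤ (∫ p, c₁ p.1 ∂m₁) + ∫ p, c₂ p.1 p.2 ∂m₂ := by
  have hπ := isMartingaleCoupling_of_mem h.add_mem
  obtain ⟨⟨hprob, -⟩, hπ₁, hπ₂, -⟩ := h.add_mem
  have := h.left.isFiniteMeasure
  have := h.right.isFiniteMeasure
  have := isFiniteMeasure_of_le γ₁ hm₁
  have := isFiniteMeasure_of_le γ₂ hm₂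
  have hle : m₁ + m₂ ≤ γ₁ + γ₂ := add_le_add hm₁ hm₂
  -- The new pieces need not lie below `γ₁ + γ₂`, but their marginals lie below `μ` and `ν`; that
  -- suffices for every integrability claim.
  have hfst_le : (m₁' + m₂').map Prod.fst ≤ (γ₁ + γ₂).map Prod.fst :=
    hfst.trans_le (Measure.map_mono hle measurable_fst)
  have hsnd_le : (m₁' + m₂').map Prod.snd ≤ (γ₁ + γ₂).map Prod.snd :=
    hsnd.trans_le (Measure.map_mono hle measurable_snd)
  have hfin : IsFiniteMeasure (m₁' + m₂') := by
    refine ⟨?_⟩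
    have := measure_lt_top ((m₁ + m₂).map Prod.fst) Set.univ
    rwa [← hfst, Measure.map_apply measurable_fst .univ, Set.preimage_univ] at this
  have hl₁ : m₁' ≤ m₁' + m₂' := Measure.le_add_right le_rfl
  have hl₂ : m₂' ≤ m₁' + m₂' := Measure.le_add_left le_rfl
  have hfin₁ := isFiniteMeasure_of_le _ hl₁
  have hfin₂ := isFiniteMeasure_of_le _ hl₂
  have hi₁ : Integrable (fun p : ℝ × ℝ => p.1) (m₁' + m₂') := by
    have h0 := (integrable_map_measure (g := fun x : ℝ => x) (by fun_prop)
      measurable_fst.aemeasurable).mpr hπ.integrable_fst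
    exact (integrable_map_measure (by fun_prop) measurable_fst.aemeasurable).mp
      (h0.mono_measure hfst_le)
  have hi₂ : Integrable (fun p : ℝ × ℝ => p.2) (m₁' + m₂') := by
    have h0 := (integrable_map_measure (g := fun x : ℝ => x) (by fun_prop)
      measurable_snd.aemeasurable).mpr hπ.integrable_snd
    exact (integrable_map_measure (by fun_prop) measurable_snd.aemeasurable).mp
      (h0.mono_measure hsnd_le)
  have hM₁ := h.left.exchange hm₁ (hi₁.mono_measure hl₁) (hi₂.mono_measure hl₁) hb₁
  have hM₂ := h.right.exchange hm₂ (hi₁.mono_measure hl₂) (hi₂.mono_measure hl₂) hb₂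
  have hsum : γ₁ - m₁ + m₁' + (γ₂ - m₂ + m₂') = (γ₁ - m₁ + (γ₂ - m₂)) + (m₁' + m₂') :=
    add_add_add_comm _ _ _ _
  have hsum' : (γ₁ - m₁ + (γ₂ - m₂)) + (m₁ + m₂) = γ₁ + γ₂ := by
    rw [add_add_add_comm, Measure.sub_add_cancel_of_le hm₁, Measure.sub_add_cancel_of_le hm₂]
  have hmap₁ : (γ₁ - m₁ + m₁' + (γ₂ - m₂ + m₂')).map Prod.fst = μ := by
    rw [hsum, Measure.map_add _ _ measurable_fst, hfst, ← Measure.map_add _ _ measurable_fst,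
      hsum', hπ₁]
  have hmap₂ : (γ₁ - m₁ + m₁' + (γ₂ - m₂ + m₂')).map Prod.snd = ν := by
    rw [hsum, Measure.map_add _ _ measurable_snd, hsnd, ← Measure.map_add _ _ measurable_snd,
      hsum', hπ₂]
  have hprob' : IsProbabilityMeasure (γ₁ - m₁ + m₁' + (γ₂ - m₂ + m₂')) := by
    refine ⟨?_⟩
    have h0 := congrArg (fun τ : Measure ℝ => τ Set.univ) (hmap₁.trans hπ₁.symm)
    simp only [Measure.map_apply measurable_fst MeasurableSet.univ, Set.preimage_univ] at h0
    rw [h0]; exact hprob.measure_univ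
  have hmem : γ₁ - m₁ + m₁' + (γ₂ - m₂ + m₂') ∈ martingaleTransports μ ν := by
    have hM : IsMartingaleCoupling (γ₁ - m₁ + m₁' + (γ₂ - m₂ + m₂')) := by
      have hsub₁ := hM₁.integrable_snd.sub hM₁.integrable_fst
      have hsub₂ := hM₂.integrable_snd.sub hM₂.integrable_fst
      refine ⟨inferInstance, hM₁.integrable_fst.add_measure hM₂.integrable_fst,
        hM₁.integrable_snd.add_measure hM₂.integrable_snd, fun S hS => ?_⟩
      rw [Measure.restrict_add]
      refine (integral_add_measure hsub₁.integrableOn hsub₂.integrableOn).trans ?_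
      exact (congrArg₂ (· + ·) (hM₁.setIntegral_eq_zero S hS)
        (hM₂.setIntegral_eq_zero S hS)).trans (add_zero 0)
    have := hM.mem_martingaleTransports
    rwa [hmap₁, hmap₂] at this
  have hint {τ : Measure (ℝ × ℝ)} (hτ : τ ≤ γ₁ + γ₂) :=
    hA.integrable hc₁ hc₂ ((Measure.map_mono hτ measurable_fst).trans_eq hπ₁)
      ((Measure.map_mono hτ measurable_snd).trans_eq hπ₂)
  have hint' {τ : Measure (ℝ × ℝ)} (hτ : τ ≤ m₁' + m₂') :=
    hA.integrable hc₁ hc₂ (((Measure.map_mono hτ measurable_fst).trans hfst_le).trans_eq hπ₁)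
      (((Measure.map_mono hτ measurable_snd).trans hsnd_le).trans_eq hπ₂)
  have hγ₁ : γ₁ ≤ γ₁ + γ₂ := Measure.le_add_right le_rfl
  have hγ₂ : γ₂ ≤ γ₁ + γ₂ := Measure.le_add_left le_rfl
  have hopt := h.le _ _ hM₁ hM₂ hmem
  have e₁ : ∫ p, c₁ p.1 ∂γ₁ = ∫ p, c₁ p.1 ∂(γ₁ - m₁) + ∫ p, c₁ p.1 ∂m₁ := by
    rw [← integral_add_measure (hint (Measure.sub_le.trans hγ₁)).1 (hint (hm₁.trans hγ₁)).1,
      Measure.sub_add_cancel_of_le hm₁]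
  have e₂ : ∫ p, c₂ p.1 p.2 ∂γ₂ = ∫ p, c₂ p.1 p.2 ∂(γ₂ - m₂) + ∫ p, c₂ p.1 p.2 ∂m₂ := by
    rw [← integral_add_measure (hint (Measure.sub_le.trans hγ₂)).2 (hint (hm₂.trans hγ₂)).2,
      Measure.sub_add_cancel_of_le hm₂]
  rw [pairPayoff, pairPayoff,
    integral_add_measure (hint (Measure.sub_le.trans hγ₁)).1 (hint' hl₁).1,
    integral_add_measure (hint (Measure.sub_le.trans hγ₂)).2 (hint' hl₂).2, e₁, e₂] at hopt
  exact ⟨⟨(hint (hm₂.trans hγ₂)).2, (hint' hl₂).2⟩, by linarith⟩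

/-- Merging, in `γ₁`, masses at `(X, Y₁)` and `(X, Y₂)` into `(X, Z)` while splitting, in `γ₂`, the
mass at `(X', Z)` into `(X', Y₁)` and `(X', Y₂)` does not improve an optimal pair. -/
lemma IsRelaxedOptimal.split_le {c₁ : ℝ → ℝ} {c₂ : ℝ → ℝ → ℝ} {μ ν : Measure ℝ}
    {γ₁ γ₂ : Measure (ℝ × ℝ)} (h : IsRelaxedOptimal c₁ c₂ μ ν γ₁ γ₂)
    (hA : IsDominated c₁ c₂ μ ν) (hc₁ : Continuous c₁)
    (hc₂ : Continuous (fun p : ℝ × ℝ => c₂ p.1 p.2))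
    {Ω : Type*} [MeasurableSpace Ω] {α β : Measure Ω} {X X' Y₁ Y₂ Z : Ω → ℝ}
    (hX : Measurable X) (hX' : Measurable X') (hY₁ : Measurable Y₁) (hY₂ : Measurable Y₂)
    (hZ : Measurable Z)
    (hle₁ : α.map (fun ω => (X ω, Y₁ ω)) + β.map (fun ω => (X ω, Y₂ ω)) ≤ γ₁)
    (hle₂ : α.map (fun ω => (X' ω, Z ω)) + β.map (fun ω => (X' ω, Z ω)) ≤ γ₂)
    (hbal : ∀ S : Set Ω, MeasurableSet S →
      ∫ ω in S, (Z ω - Y₁ ω) ∂α = ∫ ω in S, (Y₂ ω - Z ω) ∂β) :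
    Integrable (fun ω => c₂ (X' ω) (Y₁ ω)) α ∧ Integrable (fun ω => c₂ (X' ω) (Y₂ ω)) β ∧
    Integrable (fun ω => c₂ (X' ω) (Z ω)) α ∧ Integrable (fun ω => c₂ (X' ω) (Z ω)) β ∧
    (∫ ω, c₂ (X' ω) (Y₁ ω) ∂α) + ∫ ω, c₂ (X' ω) (Y₂ ω) ∂β ≤
      (∫ ω, c₂ (X' ω) (Z ω) ∂α) + ∫ ω, c₂ (X' ω) (Z ω) ∂β := by
  have mXY₁ : Measurable fun ω => (X ω, Y₁ ω) := hX.prodMk hY₁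
  have mXY₂ : Measurable fun ω => (X ω, Y₂ ω) := hX.prodMk hY₂
  have mXZ : Measurable fun ω => (X ω, Z ω) := hX.prodMk hZ
  have mXY₁' : Measurable fun ω => (X' ω, Y₁ ω) := hX'.prodMk hY₁
  have mXY₂' : Measurable fun ω => (X' ω, Y₂ ω) := hX'.prodMk hY₂
  have mXZ' : Measurable fun ω => (X' ω, Z ω) := hX'.prodMk hZ
  have key {τ : Measure Ω} {U V : Ω → ℝ} (hU : Measurable U) (hV : Measurable V)
      {γ : Measure (ℝ × ℝ)} (hγ : IsMartingaleCoupling γ)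
      (hτ : τ.map (fun ω => (U ω, V ω)) ≤ γ) : Integrable U τ ∧ Integrable V τ :=
    ⟨(integrable_map_measure (g := Prod.fst) (by fun_prop) (hU.prodMk hV).aemeasurable).mp
      (hγ.integrable_fst.mono_measure hτ),
    (integrable_map_measure (g := Prod.snd) (by fun_prop) (hU.prodMk hV).aemeasurable).mp
      (hγ.integrable_snd.mono_measure hτ)⟩
  obtain ⟨iXα, iY₁α⟩ := key hX hY₁ h.left ((Measure.le_add_right le_rfl).trans hle₁)
  obtain ⟨iXβ, iY₂β⟩ := key hX hY₂ h.left ((Measure.le_add_left le_rfl).trans hle₁)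
  obtain ⟨iX'α, iZα⟩ := key hX' hZ h.right ((Measure.le_add_right le_rfl).trans hle₂)
  obtain ⟨iX'β, iZβ⟩ := key hX' hZ h.right ((Measure.le_add_left le_rfl).trans hle₂)
  have push {U V₁ V₂ : Ω → ℝ} (hU : Measurable U) (hV₁ : Measurable V₁) (hV₂ : Measurable V₂)
      (iUα : Integrable U α) (iUβ : Integrable U β)
      (iV₁ : Integrable V₁ α) (iV₂ : Integrable V₂ β) (S : Set ℝ) (hS : MeasurableSet S) :
      ∫ p in Prod.fst ⁻¹' S, (p.2 - p.1) ∂(α.map (fun ω => (U ω, V₁ ω))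
        + β.map (fun ω => (U ω, V₂ ω))) =
      (∫ ω in U ⁻¹' S, (V₁ ω - U ω) ∂α) + ∫ ω in U ⁻¹' S, (V₂ ω - U ω) ∂β := by
    have hsm : AEStronglyMeasurable (fun p : ℝ × ℝ => p.2 - p.1)
      (α.map (fun ω => (U ω, V₁ ω))) := by fun_prop
    have hsm' : AEStronglyMeasurable (fun p : ℝ × ℝ => p.2 - p.1)
      (β.map (fun ω => (U ω, V₂ ω))) := by fun_prop
    have i₁ := (integrable_map_measure hsm (hU.prodMk hV₁).aemeasurable).mpr (iV₁.sub iUα)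
    have i₂ := (integrable_map_measure hsm' (hU.prodMk hV₂).aemeasurable).mpr (iV₂.sub iUβ)
    rw [Measure.restrict_add, integral_add_measure i₁.integrableOn i₂.integrableOn,
      setIntegral_map (measurable_fst hS) hsm (hU.prodMk hV₁).aemeasurable,
      setIntegral_map (measurable_fst hS) hsm' (hU.prodMk hV₂).aemeasurable]
    rfl
  -- `hbal` says that `Z` is the barycentre of `Y₁, Y₂` with weights `α, β`. Being local on `Ω`, it
  -- serves the fibres of both `X` and `X'`.
  have balance {U : Ω → ℝ} (iUα : Integrable U α) (iUβ : Integrable U β)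
      (S : Set Ω) (hS : MeasurableSet S) :
      (∫ ω in S, (Y₁ ω - U ω) ∂α) + ∫ ω in S, (Y₂ ω - U ω) ∂β =
      (∫ ω in S, (Z ω - U ω) ∂α) + ∫ ω in S, (Z ω - U ω) ∂β := by
    have := hbal S hS
    rw [integral_sub iZα.integrableOn iY₁α.integrableOn,
      integral_sub iY₂β.integrableOn iZβ.integrableOn] at this
    rw [integral_sub iY₁α.integrableOn iUα.integrableOn,
      integral_sub iY₂β.integrableOn iUβ.integrableOn,
      integral_sub iZα.integrableOn iUα.integrableOn,
      integral_sub iZβ.integrableOn iUβ.integrableOn]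
    linarith
  have hcomp {W : Ω → ℝ × ℝ} (hW : Measurable W) (τ : Measure Ω) :
      (τ.map W).map Prod.fst = τ.map (fun ω => (W ω).1) ∧
      (τ.map W).map Prod.snd = τ.map (fun ω => (W ω).2) :=
    ⟨Measure.map_map measurable_fst hW, Measure.map_map measurable_snd hW⟩
  obtain ⟨⟨I₂, I₂'⟩, hineq⟩ := h.exchange_le hA hc₁ hc₂ hle₁ hle₂
    (m₁' := α.map (fun ω => (X ω, Z ω)) + β.map (fun ω => (X ω, Z ω)))
    (m₂' := α.map (fun ω => (X' ω, Y₁ ω)) + β.map (fun ω => (X' ω, Y₂ ω)))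
    (by simp only [Measure.map_add _ _ measurable_fst, hcomp mXY₁, hcomp mXY₂, hcomp mXZ,
          hcomp mXY₁', hcomp mXY₂', hcomp mXZ'])
    (by simp only [Measure.map_add _ _ measurable_snd, hcomp mXY₁, hcomp mXY₂, hcomp mXZ,
          hcomp mXY₁', hcomp mXY₂', hcomp mXZ']
        rw [add_comm])
    (fun S hS => by
      rw [push hX hY₁ hY₂ iXα iXβ iY₁α iY₂β S hS, push hX hZ hZ iXα iXβ iZα iZβ S hS,
        balance iXα iXβ _ (hX hS)])
    (fun S hS => by
      rw [push hX' hY₁ hY₂ iX'α iX'β iY₁α iY₂β S hS, push hX' hZ hZ iX'α iX'β iZα iZβ S hS,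
        balance iX'α iX'β _ (hX' hS)])
  -- The merge over `X` leaves the first marginal alone, so the `c₁` term is unchanged.
  have hc₁eq : ∫ p, c₁ p.1 ∂(α.map (fun ω => (X ω, Z ω)) + β.map (fun ω => (X ω, Z ω))) =
      ∫ p, c₁ p.1 ∂(α.map (fun ω => (X ω, Y₁ ω)) + β.map (fun ω => (X ω, Y₂ ω))) := by
    rw [← integral_map (φ := Prod.fst) measurable_fst.aemeasurable hc₁.aestronglyMeasurable,
      ← integral_map (φ := Prod.fst) measurable_fst.aemeasurable hc₁.aestronglyMeasurable]
    simp only [Measure.map_add _ _ measurable_fst, hcomp mXY₁, hcomp mXY₂, hcomp mXZ]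
  have pull {W : Ω → ℝ × ℝ} (hW : Measurable W) {τ : Measure Ω}
      (hi : Integrable (fun p : ℝ × ℝ => c₂ p.1 p.2) (τ.map W)) :
      Integrable (fun ω => c₂ (W ω).1 (W ω).2) τ ∧
      ∫ p, c₂ p.1 p.2 ∂(τ.map W) = ∫ ω, c₂ (W ω).1 (W ω).2 ∂τ :=
    ⟨(integrable_map_measure hc₂.aestronglyMeasurable hW.aemeasurable).mp hi,
      integral_map hW.aemeasurable hc₂.aestronglyMeasurable⟩
  have J₁ := I₂'.mono_measure (Measure.le_add_right le_rfl)
  have J₂ := I₂'.mono_measure (Measure.le_add_left le_rfl)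
  have J₃ := I₂.mono_measure (Measure.le_add_right le_rfl)
  have J₄ := I₂.mono_measure (Measure.le_add_left le_rfl)
  refine ⟨(pull mXY₁' J₁).1, (pull mXY₂' J₂).1, (pull mXZ' J₃).1, (pull mXZ' J₄).1, ?_⟩
  rw [hc₁eq, integral_add_measure J₁ J₂, integral_add_measure J₃ J₄, (pull mXY₁' J₁).2,
    (pull mXY₂' J₂).2, (pull mXZ' J₃).2, (pull mXZ' J₄).2] at hineq
  linarith

/-! ### Strict convexity: no mass strictly between two points of a fibre -/

lemma compProd_prod_map {ρ : Measure ℝ} {κ : Kernel ℝ ℝ} [IsFiniteMeasure ρ]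
    [IsMarkovKernel κ] :
    (ρ ⊗ₘ (κ ×ₖ κ)).map (fun p : ℝ × ℝ × ℝ => (p.1, p.2.1)) = ρ ⊗ₘ κ ∧
    (ρ ⊗ₘ (κ ×ₖ κ)).map (fun p : ℝ × ℝ × ℝ => (p.1, p.2.2)) = ρ ⊗ₘ κ := by
  constructor <;>
  · ext s hs
    rw [Measure.map_apply (by fun_prop) hs, Measure.compProd_apply (by measurability),
      Measure.compProd_apply hs]
    refine lintegral_congr fun x => ?_
    rw [Kernel.prod_apply]
    first
    | have : (Prod.mk x ⁻¹' ((fun p : ℝ × ℝ × ℝ => (p.1, p.2.1)) ⁻¹' s)) =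
          (Prod.mk x ⁻¹' s) ×ˢ (Set.univ : Set ℝ) := by ext; simp
      rw [this, Measure.prod_prod, measure_univ, mul_one]
    | have : (Prod.mk x ⁻¹' ((fun p : ℝ × ℝ × ℝ => (p.1, p.2.2)) ⁻¹' s)) =
          (Set.univ : Set ℝ) ×ˢ (Prod.mk x ⁻¹' s) := by ext; simp
      rw [this, Measure.prod_prod, measure_univ, one_mul]

lemma strictConvexOn_mul_lt {f : ℝ → ℝ} (hf : StrictConvexOn ℝ Set.univ f) {x y z : ℝ}
    (hxy : x < y) (hyz : y < z) : (z - x) * f y < (z - y) * f x + (y - x) * f z := by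
  have := hf.slope_strict_mono_adjacent (Set.mem_univ x) (Set.mem_univ z) hxy hyz
  rw [div_lt_div_iff₀ (sub_pos.mpr hxy) (sub_pos.mpr hyz)] at this
  linarith

/-- The part `ρ ⊗ κ` common to both components of an optimal pair: almost surely, no point of the
second marginal lies strictly between two points of one and the same `κ x`. -/
lemma IsRelaxedOptimal.ae_not_between {c₁ : ℝ → ℝ} {c₂ : ℝ → ℝ → ℝ} {μ ν : Measure ℝ}
    {γ₁ γ₂ : Measure (ℝ × ℝ)} (h : IsRelaxedOptimal c₁ c₂ μ ν γ₁ γ₂)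
    (hA : IsDominated c₁ c₂ μ ν) (hc₁ : Continuous c₁)
    (hc₂ : Continuous (fun p : ℝ × ℝ => c₂ p.1 p.2))
    {ρ : Measure ℝ} {κ : Kernel ℝ ℝ} [IsFiniteMeasure ρ] [IsMarkovKernel κ]
    (hρ : ρ Set.univ ≤ 1) (hle₁ : ρ ⊗ₘ κ ≤ γ₁) (hle₂ : ρ ⊗ₘ κ ≤ γ₂)
    (hconv : ∀ᵐ x ∂ρ, StrictConvexOn ℝ Set.univ (c₂ x)) :
    ∀ᵐ ω ∂((ρ ⊗ₘ (κ ×ₖ κ)).prod (ρ ⊗ₘ κ)), ¬ (ω.1.2.1 < ω.2.2 ∧ ω.2.2 < ω.1.2.2) := by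
  -- Read `ω` as `((x, y₁, y₂), (x', z))`, with `y₁, y₂` conditionally independent given `x`; `E`
  -- below is the event `y₁ < z < y₂`.
  set Q := (ρ ⊗ₘ (κ ×ₖ κ)).prod (ρ ⊗ₘ κ) with hQ
  let E : Set ((ℝ × ℝ × ℝ) × ℝ × ℝ) := {ω | ω.1.2.1 < ω.2.2 ∧ ω.2.2 < ω.1.2.2}
  have hE : MeasurableSet E := by
    have h₁ : MeasurableSet {ω : (ℝ × ℝ × ℝ) × ℝ × ℝ | ω.1.2.1 < ω.2.2} :=
      measurableSet_lt (by fun_prop) (by fun_prop)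
    have h₂ : MeasurableSet {ω : (ℝ × ℝ × ℝ) × ℝ × ℝ | ω.2.2 < ω.1.2.2} :=
      measurableSet_lt (by fun_prop) (by fun_prop)
    exact h₁.inter h₂
  -- The barycentric weights `y₂ - z` and `z - y₁` are divided by `D` to be at most `1/2`; the `α`
  -- and `β` images then fit together under one copy of `ρ ⊗ₘ κ`.
  let D : (ℝ × ℝ × ℝ) × ℝ × ℝ → ℝ := fun ω => 2 * (1 + |ω.1.2.1| + |ω.1.2.2| + |ω.2.2|)
  have hD : ∀ ω, 0 < D ω := fun ω => by simp only [D]; positivity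
  let a : (ℝ × ℝ × ℝ) × ℝ × ℝ → NNReal :=
    E.indicator fun ω => ((ω.1.2.2 - ω.2.2) / D ω).toNNReal
  let b : (ℝ × ℝ × ℝ) × ℝ × ℝ → NNReal :=
    E.indicator fun ω => ((ω.2.2 - ω.1.2.1) / D ω).toNNReal
  have ha : Measurable a := Measurable.indicator (by fun_prop) hE
  have hb : Measurable b := Measurable.indicator (by fun_prop) hE
  have haE : ∀ ω ∈ E, (a ω : ℝ) = (ω.1.2.2 - ω.2.2) / D ω := fun ω hω => by
    simp only [a, Set.indicator_of_mem hω]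
    exact Real.coe_toNNReal _ (div_nonneg (sub_nonneg.mpr hω.2.le) (hD ω).le)
  have hbE : ∀ ω ∈ E, (b ω : ℝ) = (ω.2.2 - ω.1.2.1) / D ω := fun ω hω => by
    simp only [b, Set.indicator_of_mem hω]
    exact Real.coe_toNNReal _ (div_nonneg (sub_nonneg.mpr hω.1.le) (hD ω).le)
  have haE' : ∀ ω ∉ E, a ω = 0 := fun ω hω => Set.indicator_of_notMem hω _
  have hbE' : ∀ ω ∉ E, b ω = 0 := fun ω hω => Set.indicator_of_notMem hω _
  have ha_le : ∀ ω, (a ω : ℝ≥0∞) ≤ 2⁻¹ := fun ω => by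
    by_cases hω : ω ∈ E
    · have : a ω ≤ 2⁻¹ := by
        rw [← NNReal.coe_le_coe, haE ω hω, div_le_iff₀ (hD ω)]
        simp only [D, NNReal.coe_inv, NNReal.coe_ofNat]
        linarith [le_abs_self ω.1.2.2, neg_abs_le ω.2.2, abs_nonneg ω.1.2.1]
      calc (a ω : ℝ≥0∞) ≤ ((2⁻¹ : NNReal) : ℝ≥0∞) := by exact_mod_cast this
        _ = 2⁻¹ := by simp
    · simp [haE' ω hω]
  have hb_le : ∀ ω, (b ω : ℝ≥0∞) ≤ 2⁻¹ := fun ω => by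
    by_cases hω : ω ∈ E
    · have : b ω ≤ 2⁻¹ := by
        rw [← NNReal.coe_le_coe, hbE ω hω, div_le_iff₀ (hD ω)]
        simp only [D, NNReal.coe_inv, NNReal.coe_ofNat]
        linarith [le_abs_self ω.2.2, neg_abs_le ω.1.2.1, abs_nonneg ω.1.2.2]
      calc (b ω : ℝ≥0∞) ≤ ((2⁻¹ : NNReal) : ℝ≥0∞) := by exact_mod_cast this
        _ = 2⁻¹ := by simp
    · simp [hbE' ω hω]
  have hdens {g : (ℝ × ℝ × ℝ) × ℝ × ℝ → NNReal} (hg : ∀ ω, (g ω : ℝ≥0∞) ≤ 2⁻¹) :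
      Q.withDensity (fun ω => (g ω : ℝ≥0∞)) ≤ (2⁻¹ : ℝ≥0∞) • Q := by
    rw [← withDensity_const]
    exact withDensity_mono (.of_forall hg)
  have hhalf {W : (ℝ × ℝ × ℝ) × ℝ × ℝ → ℝ × ℝ} (hW : Measurable W)
      (hWQ : Q.map W ≤ ρ ⊗ₘ κ) :
      ∀ τ ≤ (2⁻¹ : ℝ≥0∞) • Q, τ.map W ≤ (2⁻¹ : ℝ≥0∞) • (ρ ⊗ₘ κ) := fun τ hτ => by
    refine (Measure.map_mono hτ hW).trans ?_
    rw [Measure.map_smul]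
    gcongr
  have hsum : (2⁻¹ : ℝ≥0∞) • (ρ ⊗ₘ κ) + (2⁻¹ : ℝ≥0∞) • (ρ ⊗ₘ κ) = ρ ⊗ₘ κ := by
    rw [← add_smul, ENNReal.inv_two_add_inv_two, one_smul]
  have hsmul_le {c : ℝ≥0∞} (hc : c ≤ 1) : c • (ρ ⊗ₘ κ) ≤ ρ ⊗ₘ κ := by
    conv_rhs => rw [← one_smul ℝ≥0∞ (ρ ⊗ₘ κ)]
    gcongr
  -- Projecting `Q` multiplies by the mass of the forgotten factor, whence the assumption `ρ
  -- Set.univ ≤ 1`.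
  have hmapY₁ : Q.map (fun ω => (ω.1.1, ω.1.2.1)) ≤ ρ ⊗ₘ κ := by
    have : Q.map (fun ω => (ω.1.1, ω.1.2.1)) =
        (Q.map Prod.fst).map (fun p : ℝ × ℝ × ℝ => (p.1, p.2.1)) :=
      (Measure.map_map (g := fun p : ℝ × ℝ × ℝ => (p.1, p.2.1)) (by fun_prop) measurable_fst).symm
    rw [this, hQ, Measure.map_fst_prod, Measure.map_smul, compProd_prod_map.1]
    exact hsmul_le (by simpa using hρ)
  have hmapY₂ : Q.map (fun ω => (ω.1.1, ω.1.2.2)) ≤ ρ ⊗ₘ κ := by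
    have : Q.map (fun ω => (ω.1.1, ω.1.2.2)) =
        (Q.map Prod.fst).map (fun p : ℝ × ℝ × ℝ => (p.1, p.2.2)) :=
      (Measure.map_map (g := fun p : ℝ × ℝ × ℝ => (p.1, p.2.2)) (by fun_prop) measurable_fst).symm
    rw [this, hQ, Measure.map_fst_prod, Measure.map_smul, compProd_prod_map.2]
    exact hsmul_le (by simpa using hρ)
  have hmapZ : Q.map (fun ω => (ω.2.1, ω.2.2)) ≤ ρ ⊗ₘ κ := by
    have : Q.map (fun ω => (ω.2.1, ω.2.2)) = Q.map Prod.snd := rfl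
    rw [this, hQ, Measure.map_snd_prod]
    exact hsmul_le (by simpa using hρ)
  obtain ⟨i₁, i₂, i₃, i₄, hineq⟩ := h.split_le hA hc₁ hc₂
    (α := Q.withDensity fun ω => (a ω : ℝ≥0∞)) (β := Q.withDensity fun ω => (b ω : ℝ≥0∞))
    (X := fun ω => ω.1.1) (X' := fun ω => ω.2.1) (Y₁ := fun ω => ω.1.2.1)
    (Y₂ := fun ω => ω.1.2.2) (Z := fun ω => ω.2.2)
    (by fun_prop) (by fun_prop) (by fun_prop) (by fun_prop) (by fun_prop)
    (((add_le_add (hhalf (by fun_prop) hmapY₁ _ (hdens ha_le))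
      (hhalf (by fun_prop) hmapY₂ _ (hdens hb_le))).trans_eq hsum).trans hle₁)
    (((add_le_add (hhalf (by fun_prop) hmapZ _ (hdens ha_le))
      (hhalf (by fun_prop) hmapZ _ (hdens hb_le))).trans_eq hsum).trans hle₂)
    (fun S hS => by
      rw [setIntegral_withDensity_eq_setIntegral_smul ha _ hS,
        setIntegral_withDensity_eq_setIntegral_smul hb _ hS]
      congr 1
      ext ω
      by_cases hω : ω ∈ E
      · simp only [NNReal.smul_def, haE ω hω, hbE ω hω, smul_eq_mul]
        ring
      · simp [haE' ω hω, hbE' ω hω])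
  rw [integral_withDensity_eq_integral_smul ha, integral_withDensity_eq_integral_smul hb,
    integral_withDensity_eq_integral_smul ha, integral_withDensity_eq_integral_smul hb] at hineq
  rw [integrable_withDensity_iff_integrable_smul ha] at i₁ i₃
  rw [integrable_withDensity_iff_integrable_smul hb] at i₂ i₄
  have hconvQ : ∀ᵐ ω ∂Q, StrictConvexOn ℝ Set.univ (c₂ ω.2.1) := by
    have h1 : ∀ᵐ p ∂(ρ ⊗ₘ κ), StrictConvexOn ℝ Set.univ (c₂ p.1) := by
      have : (ρ ⊗ₘ κ).map Prod.fst = ρ := Measure.fst_compProd ρ κ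
      rw [← this] at hconv
      exact ae_of_ae_map measurable_fst.aemeasurable hconv
    exact Measure.quasiMeasurePreserving_snd.ae h1
  -- `G` is the density of the gain: its integral is at most `0` by optimality, while it is positive
  -- on `E` and zero elsewhere.
  let G : (ℝ × ℝ × ℝ) × ℝ × ℝ → ℝ := fun ω =>
    (a ω • c₂ ω.2.1 ω.1.2.1 + b ω • c₂ ω.2.1 ω.1.2.2)
      - (a ω • c₂ ω.2.1 ω.2.2 + b ω • c₂ ω.2.1 ω.2.2)
  have hGi : Integrable G Q := (i₁.add i₂).sub (i₃.add i₄)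
  have hG : ∫ ω, G ω ∂Q ≤ 0 := by
    have e : ∫ ω, G ω ∂Q = _ := integral_sub (i₁.add i₂) (i₃.add i₄)
    rw [e, integral_add i₁ i₂, integral_add i₃ i₄]
    linarith
  have hGpos : ∀ ω, StrictConvexOn ℝ Set.univ (c₂ ω.2.1) → ω ∈ E → 0 < G ω := by
    intro ω hc hω
    have := strictConvexOn_mul_lt hc hω.1 hω.2
    have e : G ω = ((ω.1.2.2 - ω.2.2) * c₂ ω.2.1 ω.1.2.1 + (ω.2.2 - ω.1.2.1) * c₂ ω.2.1 ω.1.2.2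
        - (ω.1.2.2 - ω.1.2.1) * c₂ ω.2.1 ω.2.2) / D ω := by
      simp only [G, NNReal.smul_def, haE ω hω, hbE ω hω, smul_eq_mul]
      ring
    rw [e]
    exact div_pos (by linarith) (hD ω)
  have hG0 : 0 ≤ᵐ[Q] G := by
    filter_upwards [hconvQ] with ω hc
    by_cases hω : ω ∈ E
    · exact (hGpos ω hc hω).le
    · simp [G, haE' ω hω, hbE' ω hω]
  have hGz := (integral_eq_zero_iff_of_nonneg_ae hG0 hGi).mp
    (le_antisymm hG (integral_nonneg_of_ae hG0))
  filter_upwards [hconvQ, hGz] with ω hc hz hω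
  exact (hGpos ω hc hω).ne' hz

/-! ### Collapse of the fibres to the diagonal -/

/-- Such a point is outside the support or isolated in it from the right; the latter points are
countable, hence null for an atomless measure. -/
lemma measure_null_right_gap_eq_zero (m : Measure ℝ) [NullSingletonClass m] :
    m {y | ∃ z, y < z ∧ m (Set.Ioo y z) = 0} = 0 := by
  have hsub : {y | ∃ z, y < z ∧ m (Set.Ioo y z) = 0} ⊆
      m.supportᶜ ∪ {y ∈ m.support | nhdsWithin y (m.support ∩ Set.Ioi y) = ⊥} := by
    rintro y ⟨z, hyz, hz⟩
    by_cases hy : y ∈ m.support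
    · refine Or.inr ⟨hy, ?_⟩
      rw [← Filter.empty_mem_iff_bot, mem_nhdsWithin]
      refine ⟨Set.Iio z, isOpen_Iio, hyz, ?_⟩
      rintro t ⟨htz, hts, hyt⟩
      exact Measure.subset_compl_support_of_isOpen isOpen_Ioo hz ⟨hyt, htz⟩ hts
    · exact Or.inl hy
  refine measure_mono_null hsub (measure_union_null Measure.measure_compl_support ?_)
  exact Set.Countable.measure_zero countable_setOfPred_isolated_right_within m

/-- Almost surely the interval from `y₁` to `y₂` is null, yet almost every `y₁` has no null gap to
its right. So `y₂ ≤ y₁` for almost all pairs in a fibre. -/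
lemma ae_snd_eq_fst_of_ae_not_between {ρ : Measure ℝ} {κ : Kernel ℝ ℝ} [IsFiniteMeasure ρ]
    [IsMarkovKernel κ] (hm : IsMartingaleCoupling (ρ ⊗ₘ κ))
    (hac : (ρ ⊗ₘ κ).map Prod.snd ≪ volume)
    (h : ∀ᵐ ω ∂((ρ ⊗ₘ (κ ×ₖ κ)).prod (ρ ⊗ₘ κ)), ¬ (ω.1.2.1 < ω.2.2 ∧ ω.2.2 < ω.1.2.2)) :
    ∀ᵐ p ∂(ρ ⊗ₘ κ), p.2 = p.1 := by
  set m := (ρ ⊗ₘ κ).map Prod.snd with hm_def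
  have : NullSingletonClass m := ⟨fun x => hac (measure_singleton x)⟩
  have hgap : ∀ᵐ q ∂(ρ ⊗ₘ (κ ×ₖ κ)), m (Set.Ioo q.2.1 q.2.2) = 0 := by
    filter_upwards [Measure.ae_ae_of_ae_prod h] with q hq
    rw [hm_def, Measure.map_apply measurable_snd measurableSet_Ioo]
    refine measure_mono_null ?_ (ae_iff.mp hq)
    intro p hp
    simpa using hp
  have hnull : ∀ᵐ q ∂(ρ ⊗ₘ (κ ×ₖ κ)), ¬ ∃ z, q.2.1 < z ∧ m (Set.Ioo q.2.1 z) = 0 := by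
    have h0 : ∀ᵐ y ∂m, ¬ ∃ z, y < z ∧ m (Set.Ioo y z) = 0 := by
      rw [ae_iff]
      simpa only [not_not] using measure_null_right_gap_eq_zero m
    have h1 := ae_of_ae_map measurable_snd.aemeasurable h0
    rw [← compProd_prod_map.1] at h1
    exact ae_of_ae_map (f := fun q : ℝ × ℝ × ℝ => (q.1, q.2.1))
      (p := fun p => ¬ ∃ z, p.2 < z ∧ m (Set.Ioo p.2 z) = 0) (by fun_prop) h1
  have hle : ∀ᵐ q ∂(ρ ⊗ₘ (κ ×ₖ κ)), q.2.2 ≤ q.2.1 := by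
    filter_upwards [hgap, hnull] with q h₁ h₂
    by_contra hlt
    exact h₂ ⟨q.2.2, not_le.mp hlt, h₁⟩
  refine Measure.ae_compProd_of_ae_ae (measurableSet_eq_fun measurable_snd measurable_fst) ?_
  filter_upwards [Measure.ae_ae_of_ae_compProd hle, hm.ae_barycenter] with x hx hbar
  rw [Kernel.prod_apply] at hx
  -- Almost every `y` dominates almost all of its fibre, hence the mean `x`; then `y - x` is
  -- nonnegative with mean zero.
  have hxy : ∀ᵐ y ∂κ x, x ≤ y := by
    filter_upwards [Measure.ae_ae_of_ae_prod hx] with y hy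
    calc x = ∫ z, z ∂κ x := hbar.2.symm
      _ ≤ ∫ _, y ∂κ x := integral_mono_ae hbar.1 (integrable_const y) hy
      _ = y := by simp
  have h0 : 0 ≤ᵐ[κ x] fun y => y - x := by
    filter_upwards [hxy] with y hy using sub_nonneg.mpr hy
  have hint : Integrable (fun y => y - x) (κ x) := hbar.1.sub (integrable_const x)
  have := (integral_eq_zero_iff_of_nonneg_ae h0 hint).mp
    (by rw [integral_sub hbar.1 (integrable_const x), hbar.2]; simp)
  filter_upwards [this] with y hy using sub_eq_zero.mp hy

/-- On the diagonal, an optimal pair cannot use both exercise dates at a point where the two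
payoffs differ. -/
lemma IsRelaxedOptimal.eq_zero_of_diagonal {c₁ : ℝ → ℝ} {c₂ : ℝ → ℝ → ℝ} {μ ν : Measure ℝ}
    {γ₁ γ₂ σ : Measure (ℝ × ℝ)} (h : IsRelaxedOptimal c₁ c₂ μ ν γ₁ γ₂)
    (hA : IsDominated c₁ c₂ μ ν) (hc₁ : Continuous c₁)
    (hc₂ : Continuous (fun p : ℝ × ℝ => c₂ p.1 p.2))
    (hle₁ : σ ≤ γ₁) (hle₂ : σ ≤ γ₂) (hdiag : ∀ᵐ p ∂σ, p.2 = p.1)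
    (hne : ∀ᵐ p ∂σ, c₁ p.1 ≠ c₂ p.1 p.1) : σ = 0 := by
  obtain ⟨-, hπ₁, hπ₂, -⟩ := h.add_mem
  have hle : σ ≤ γ₁ + γ₂ := hle₁.trans (Measure.le_add_right le_rfl)
  obtain ⟨i₁, i₂⟩ := hA.integrable hc₁ hc₂ ((Measure.map_mono hle measurable_fst).trans_eq hπ₁)
    ((Measure.map_mono hle measurable_snd).trans_eq hπ₂)
  -- Diagonal mass has no displacement, so any part of it may pass from one component to the other.
  have hbar (A : Set (ℝ × ℝ)) (S : Set ℝ) :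
      ∫ p in Prod.fst ⁻¹' S, (p.2 - p.1) ∂(σ.restrict A) = 0 := by
    refine integral_eq_zero_of_ae (ae_restrict_of_ae (ae_restrict_of_ae ?_))
    filter_upwards [hdiag] with p hp using sub_eq_zero.mpr hp
  have hpos : ∀ᵐ p ∂σ, ¬ c₂ p.1 p.2 < c₁ p.1 := by
    let A : Set (ℝ × ℝ) := {p | c₂ p.1 p.2 < c₁ p.1}
    have hAm : MeasurableSet A := measurableSet_lt hc₂.measurable (by fun_prop)
    have hineq := (h.exchange_le hA hc₁ hc₂ (m₁ := 0) (m₂ := σ.restrict A)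
      (m₁' := σ.restrict A) (m₂' := 0) (Measure.zero_le _) (Measure.restrict_le_self.trans hle₂)
      (by simp) (by simp) (fun S _ => by simp [hbar A S]) (fun S _ => by simp [hbar A S])).2
    simp only [integral_zero_measure, add_zero, zero_add] at hineq
    have h0 : 0 ≤ᵐ[σ.restrict A] fun p => c₁ p.1 - c₂ p.1 p.2 :=
      ae_restrict_of_forall_mem hAm fun p hp => (sub_pos.mpr hp).le
    have hz := (integral_eq_zero_iff_of_nonneg_ae h0
      (i₁.integrableOn.sub i₂.integrableOn)).mp (le_antisymm
        (by rw [integral_sub i₁.integrableOn i₂.integrableOn]; linarith)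
        (integral_nonneg_of_ae h0))
    filter_upwards [(ae_restrict_iff' hAm).mp hz] with p hp hpA
    exact (sub_pos.mpr hpA).ne' (hp hpA)
  have hneg : ∀ᵐ p ∂σ, ¬ c₁ p.1 < c₂ p.1 p.2 := by
    let A : Set (ℝ × ℝ) := {p | c₁ p.1 < c₂ p.1 p.2}
    have hAm : MeasurableSet A := measurableSet_lt (by fun_prop) hc₂.measurable
    have hineq := (h.exchange_le hA hc₁ hc₂ (m₁ := σ.restrict A) (m₂ := 0)
      (m₁' := 0) (m₂' := σ.restrict A) (Measure.restrict_le_self.trans hle₁) (Measure.zero_le _)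
      (by simp) (by simp) (fun S _ => by simp [hbar A S]) (fun S _ => by simp [hbar A S])).2
    simp only [integral_zero_measure, add_zero, zero_add] at hineq
    have h0 : 0 ≤ᵐ[σ.restrict A] fun p => c₂ p.1 p.2 - c₁ p.1 :=
      ae_restrict_of_forall_mem hAm fun p hp => (sub_pos.mpr hp).le
    have hz := (integral_eq_zero_iff_of_nonneg_ae h0
      (i₂.integrableOn.sub i₁.integrableOn)).mp (le_antisymm
        (by rw [integral_sub i₂.integrableOn i₁.integrableOn]; linarith)
        (integral_nonneg_of_ae h0))
    filter_upwards [(ae_restrict_iff' hAm).mp hz] with p hp hpA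
    exact (sub_pos.mpr hpA).ne' (hp hpA)
  rw [← ae_eq_bot, ← Filter.eventually_false_iff_eq_bot]
  filter_upwards [hpos, hneg, hdiag, hne] with p h₁ h₂ h₃ h₄
  rw [h₃] at h₁ h₂
  exact h₄ (le_antisymm (not_lt.mp h₁) (not_lt.mp h₂))

/-! ### Singularity for optimal pairs -/

lemma compProd_condKernel_eq {μ ν : Measure ℝ} {π : ProbabilityMeasure (ℝ × ℝ)}
    (h : (π : Measure (ℝ × ℝ)) ∈ martingaleTransports μ ν) :
    μ ⊗ₘ (π : Measure (ℝ × ℝ)).condKernel = π := by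
  obtain ⟨-, rfl, -, -⟩ := h
  exact (π : Measure (ℝ × ℝ)).disintegrate (π : Measure (ℝ × ℝ)).condKernel

/-- The equality of the two values enters here: it lets competitors with different kernels be
compared with `(π, μ₁)`. -/
lemma IsOptimalPair.isRelaxedOptimal {μ ν : Measure ℝ} [IsFiniteMeasure μ]
    {c₁ : ℝ → ℝ} {c₂ : ℝ → ℝ → ℝ} {π : ProbabilityMeasure (ℝ × ℝ)} {μ₁ : Measure ℝ}
    (hP : value c₁ c₂ μ ν = relaxedValue c₁ c₂ μ ν) (h : IsOptimalPair c₁ c₂ μ ν π μ₁) :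
    IsRelaxedOptimal c₁ c₂ μ ν (μ₁ ⊗ₘ (π : Measure (ℝ × ℝ)).condKernel)
      ((μ - μ₁) ⊗ₘ (π : Measure (ℝ × ℝ)).condKernel) := by
  obtain ⟨hπ, hle, hval⟩ := h
  have hdis := compProd_condKernel_eq hπ
  have hm : IsMartingaleCoupling (μ ⊗ₘ (π : Measure (ℝ × ℝ)).condKernel) := by
    rw [hdis]; exact isMartingaleCoupling_of_mem hπ
  have := isFiniteMeasure_of_le μ hle
  have := isFiniteMeasure_of_le μ (Measure.sub_le (ν := μ₁))
  refine ⟨hm.compProd_of_le hle, hm.compProd_of_le Measure.sub_le, ?_, fun γ₁ γ₂ h₁ h₂ hs => ?_⟩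
  · rw [← Measure.compProd_add_left, add_comm, Measure.sub_add_cancel_of_le hle, hdis]
    exact hπ
  · rw [← EReal.coe_le_coe_iff]
    refine le_trans ?_ (hval.trans hP).ge
    rw [relaxedValue]
    exact le_iSup_of_le γ₁ (le_iSup_of_le γ₂ (le_iSup_of_le h₁.mem_finiteMartingaleTransports
      (le_iSup_of_le h₂.mem_finiteMartingaleTransports (le_iSup_of_le hs le_rfl))))

lemma IsOptimalPair.mutuallySingular {μ ν : Measure ℝ} (hμ : FiniteMomentProb μ)
    {c₁ : ℝ → ℝ} {c₂ : ℝ → ℝ → ℝ} (hc₁ : Continuous c₁)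
    (hc₂ : Continuous (fun p : ℝ × ℝ => c₂ p.1 p.2)) (hA : IsDominated c₁ c₂ μ ν)
    (hconv : ∀ᵐ x ∂μ, StrictConvexOn ℝ Set.univ (c₂ x))
    (hne : ∀ᵐ x ∂μ, c₁ x ≠ c₂ x x) (hac : ν ≪ volume)
    (hP : value c₁ c₂ μ ν = relaxedValue c₁ c₂ μ ν)
    {π : ProbabilityMeasure (ℝ × ℝ)} {μ₁ : Measure ℝ} (h : IsOptimalPair c₁ c₂ μ ν π μ₁) :
    μ₁ ⟂ₘ (μ - μ₁) := by
  have := hμ.1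
  have hopt := h.isRelaxedOptimal hP
  obtain ⟨hπ, hle, -⟩ := h
  have := isFiniteMeasure_of_le μ hle
  have := isFiniteMeasure_of_le μ (Measure.sub_le (ν := μ₁))
  -- Singularity amounts to the absence of a nonzero common minorant `ρ`.
  refine Measure.mutuallySingular_of_disjoint fun ρ hρ₁ hρ₂ => ?_
  have hρμ : ρ ≤ μ := hρ₁.trans hle
  have := isFiniteMeasure_of_le μ hρμ
  set κ := (π : Measure (ℝ × ℝ)).condKernel
  have hac' := Measure.absolutelyContinuous_of_le hρμ
  have hσ₁ : ρ ⊗ₘ κ ≤ μ₁ ⊗ₘ κ := compProd_mono_left hρ₁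
  have hσ₂ : ρ ⊗ₘ κ ≤ (μ - μ₁) ⊗ₘ κ := compProd_mono_left hρ₂
  have hsnd : (ρ ⊗ₘ κ).map Prod.snd ≪ volume := by
    refine (Measure.absolutelyContinuous_of_le ?_).trans hac
    refine (Measure.map_mono (compProd_mono_left (κ := κ) hρμ) measurable_snd).trans_eq ?_
    rw [compProd_condKernel_eq hπ]
    exact hπ.2.2.1
  have hfst : (ρ ⊗ₘ κ).map Prod.fst = ρ := Measure.fst_compProd ρ κ
  have hbetween := hopt.ae_not_between hA hc₁ hc₂
    ((hρμ Set.univ).trans_eq measure_univ) hσ₁ hσ₂ (hac'.ae_le hconv)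
  have hdiag := ae_snd_eq_fst_of_ae_not_between (hopt.left.compProd_of_le hρ₁) hsnd hbetween
  have hne' : ∀ᵐ p ∂(ρ ⊗ₘ κ), c₁ p.1 ≠ c₂ p.1 p.1 := by
    refine ae_of_ae_map (p := fun x => c₁ x ≠ c₂ x x) measurable_fst.aemeasurable ?_
    rw [hfst]
    exact hac'.ae_le hne
  have hzero := hopt.eq_zero_of_diagonal hA hc₁ hc₂ hσ₁ hσ₂ hdiag hne'
  rw [hzero, Measure.map_zero] at hfst
  exact hfst.ge

/-! ### Uniqueness of the exercise scheme -/

lemma payoff_midpoint {μ ν : Measure ℝ} [IsFiniteMeasure μ]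
    {c₁ : ℝ → ℝ} {c₂ : ℝ → ℝ → ℝ} (hc₁ : Continuous c₁)
    (hc₂ : Continuous (fun p : ℝ × ℝ => c₂ p.1 p.2)) (hA : IsDominated c₁ c₂ μ ν)
    {π : ProbabilityMeasure (ℝ × ℝ)} (hπ : (π : Measure (ℝ × ℝ)) ∈ martingaleTransports μ ν)
    {μ₁ μ₁' : Measure ℝ} (h : μ₁ ≤ μ) (h' : μ₁' ≤ μ) :
    (2⁻¹ : ℝ≥0∞) • (μ₁ + μ₁') ≤ μ ∧
    μ - (2⁻¹ : ℝ≥0∞) • (μ₁ + μ₁') = (2⁻¹ : ℝ≥0∞) • ((μ - μ₁) + (μ - μ₁')) ∧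
    payoff c₁ c₂ μ π ((2⁻¹ : ℝ≥0∞) • (μ₁ + μ₁')) =
      (payoff c₁ c₂ μ π μ₁ + payoff c₁ c₂ μ π μ₁') / 2 := by
  have f₁ := isFiniteMeasure_of_le μ h
  have f₂ := isFiniteMeasure_of_le μ h'
  have f₃ := isFiniteMeasure_of_le μ (Measure.sub_le (ν := μ₁))
  have f₄ := isFiniteMeasure_of_le μ (Measure.sub_le (ν := μ₁'))
  have htwo : (2⁻¹ : ℝ≥0∞) ≠ ∞ := by simp
  have f₅ : IsFiniteMeasure ((2⁻¹ : ℝ≥0∞) • (μ₁ + μ₁')) := Measure.smul_finite _ htwo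
  have hsum : (2⁻¹ : ℝ≥0∞) • ((μ - μ₁) + (μ - μ₁')) + (2⁻¹ : ℝ≥0∞) • (μ₁ + μ₁') = μ := by
    rw [← smul_add, add_add_add_comm, Measure.sub_add_cancel_of_le h,
      Measure.sub_add_cancel_of_le h', smul_add, ← add_smul, ENNReal.inv_two_add_inv_two, one_smul]
  have hsub : μ - (2⁻¹ : ℝ≥0∞) • (μ₁ + μ₁') = (2⁻¹ : ℝ≥0∞) • ((μ - μ₁) + (μ - μ₁')) := by
    conv_lhs => rw [← hsum]
    exact Measure.add_sub_cancel
  refine ⟨hsum ▸ Measure.le_add_left le_rfl, hsub, ?_⟩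
  have hint {τ : Measure ℝ} (hτ : τ ≤ μ) :
      Integrable (fun p : ℝ × ℝ => c₁ p.1) (τ ⊗ₘ (π : Measure (ℝ × ℝ)).condKernel) ∧
      Integrable (fun p : ℝ × ℝ => c₂ p.1 p.2) (τ ⊗ₘ (π : Measure (ℝ × ℝ)).condKernel) := by
    have hle : τ ⊗ₘ (π : Measure (ℝ × ℝ)).condKernel ≤ π :=
      (compProd_mono_left hτ).trans_eq (compProd_condKernel_eq hπ)
    exact hA.integrable hc₁ hc₂ ((Measure.map_mono hle measurable_fst).trans_eq hπ.2.1)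
      ((Measure.map_mono hle measurable_snd).trans_eq hπ.2.2.1)
  rw [payoff, payoff, payoff, hsub]
  simp only [pairPayoff, Measure.compProd_smul_left, Measure.compProd_add_left,
    integral_smul_measure]
  rw [integral_add_measure (hint h).1 (hint h').1,
    integral_add_measure (hint Measure.sub_le).2 (hint Measure.sub_le).2]
  simp only [ENNReal.toReal_inv, ENNReal.toReal_ofNat, smul_eq_mul]
  ring

/-- A set `S` separating the midpoint from its complement does so for both schemes at once, so each
is `μ` restricted to `Sᶜ`. -/
lemma eq_of_midpoint_mutuallySingular {μ μ₁ μ₁' : Measure ℝ} [IsFiniteMeasure μ]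
    (h : μ₁ ≤ μ) (h' : μ₁' ≤ μ)
    (hs : (2⁻¹ : ℝ≥0∞) • (μ₁ + μ₁') ⟂ₘ (2⁻¹ : ℝ≥0∞) • ((μ - μ₁) + (μ - μ₁'))) :
    μ₁ = μ₁' := by
  have f₁ := isFiniteMeasure_of_le μ h
  have f₂ := isFiniteMeasure_of_le μ h'
  obtain ⟨S, hS, h₀, h₁⟩ := hs
  simp only [Measure.smul_apply, Measure.add_apply, smul_eq_mul, mul_eq_zero,
    ENNReal.inv_eq_zero, ENNReal.ofNat_ne_top, false_or, add_eq_zero] at h₀ h₁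
  have key {τ : Measure ℝ} [IsFiniteMeasure τ] (hτ : τ ≤ μ) (hτ₀ : τ S = 0)
      (hτ₁ : (μ - τ) Sᶜ = 0) : τ = μ.restrict Sᶜ := by
    have e : (μ - τ).restrict Sᶜ + τ.restrict Sᶜ = μ.restrict Sᶜ := by
      rw [← Measure.restrict_add, Measure.sub_add_cancel_of_le hτ]
    rw [← e, Measure.restrict_eq_zero.mpr hτ₁, zero_add,
      Measure.restrict_eq_self_of_ae_mem (s := Sᶜ) (measure_eq_zero_iff_ae_notMem.mp hτ₀)]
  rw [key h h₀.1 h₁.1, key h' h₀.2 h₁.2]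

end AmericanOption

theorem mainTheorem1 (μ ν : Measure ℝ)
    (hμ : AmericanOption.FiniteMomentProb μ) (hν : AmericanOption.FiniteMomentProb ν)
    (hμν : AmericanOption.ConvexOrder μ ν)
    (c₁ : ℝ → ℝ) (c₂ : ℝ → ℝ → ℝ)
    (hc₁ : Continuous c₁) (hc₂ : Continuous (fun p : ℝ × ℝ => c₂ p.1 p.2))
    (hA : ∃ v w : ℝ → ℝ, Continuous v ∧ Continuous w ∧ Integrable v μ ∧ Integrable w ν ∧
      ∀ x y : ℝ, |c₁ x| + |c₂ x y| ≤ v x + w y)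
    (hconv : ∀ᵐ x ∂μ, StrictConvexOn ℝ Set.univ (c₂ x))
    (hne : ∀ᵐ x ∂μ, c₁ x ≠ c₂ x x)
    (hac : ν ≪ volume)
    (hP : AmericanOption.value c₁ c₂ μ ν = AmericanOption.relaxedValue c₁ c₂ μ ν) :
    (∀ (π : ProbabilityMeasure (ℝ × ℝ)) (μ₁ : Measure ℝ),
      AmericanOption.IsOptimalPair c₁ c₂ μ ν π μ₁ → μ₁ ⟂ₘ (μ - μ₁)) ∧
    (∀ (π : ProbabilityMeasure (ℝ × ℝ)) (μ₁ μ₁' : Measure ℝ),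
      AmericanOption.IsOptimalPair c₁ c₂ μ ν π μ₁ →
      AmericanOption.IsOptimalPair c₁ c₂ μ ν π μ₁' → μ₁ = μ₁') := by
  refine ⟨fun π μ₁ h => h.mutuallySingular hμ hc₁ hc₂ hA hconv hne hac hP,
    fun π μ₁ μ₁' h h' => ?_⟩
  have := hμ.1
  obtain ⟨hle, hsub, hpay⟩ :=
    AmericanOption.payoff_midpoint hc₁ hc₂ hA h.1 h.2.1 h'.2.1
  have heq : AmericanOption.payoff c₁ c₂ μ π μ₁ = AmericanOption.payoff c₁ c₂ μ π μ₁' :=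
    EReal.coe_injective (h.2.2.trans h'.2.2.symm)
  have hmid : AmericanOption.IsOptimalPair c₁ c₂ μ ν π ((2⁻¹ : ℝ≥0∞) • (μ₁ + μ₁')) := by
    refine ⟨h.1, hle, ?_⟩
    rw [hpay, ← heq, add_self_div_two]
    exact h.2.2
  have hs := hmid.mutuallySingular hμ hc₁ hc₂ hA hconv hne hac hP
  rw [hsub] at hs
  exact AmericanOption.eq_of_midpoint_mutuallySingular h.2.1 h'.2.1 hs
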